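/- Let $\Delta$ be a finite set of pairwise commuting derivations (acting on all differential rings below); all rings are commutative with identity. For a differential ring $R$, let $\operatorname{Spec}^\Delta R$ be the set of prime ideals of $R$ stable under $\Delta$, with the topology induced by the Zariski topology of $\operatorname{Spec} R$. Let $A\subseteq B$ be an extension of differential rings that are $\mathbb{Q}$-algebras (differential Ritt algebras), such that $B$ is an integral domain and is differentially finitely generated over $A$, i.e. $B$ is generated as an $A$-algebra by finitely many elements together with all their iterated derivatives. Suppose that $\operatorname{Spec}^\Delta A$ is a noetherian topological space. Then there exists a nonzero element $s\in B$ such that the contraction map $\operatorname{Spec}^\Delta B_s\to \operatorname{Spec}^\Delta A$, $\mathfrak q\mapsto \mathfrak q\cap A$ (the preimage of $\mathfrak q$ under $A\to B_s$), is open, where $B_s$ is the localization of $B$ at the powers of $s$, with the derivations extended by the quotient rule. -/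

import Mathlib

/-- A structure of differential ring on the commutative ring `R`: a family of pairwise commuting
derivations of `R`, indexed by `Δ`. (The set `Δ` is taken finite in the theorem.) -/
class DeltaRing (Δ : Type*) (R : Type*) [CommRing R] where
  der : Δ → Derivation ℤ R R
  der_comm : ∀ (i j : Δ) (x : R), der i (der j x) = der j (der i x)

/-- A ring homomorphism is differential if it commutes with all the derivations in `Δ`. -/
def IsDeltaHom (Δ : Type*) {R S : Type*} [CommRing R] [CommRing S] [DeltaRing Δ R] [DeltaRing Δ S]
    (f : R →+* S) : Prop :=
  ∀ (i : Δ) (x : R), f (DeltaRing.der i x) = DeltaRing.der i (f x)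

theorem IsDeltaHom.comp {Δ R S T : Type*} [CommRing R] [CommRing S] [CommRing T]
    [DeltaRing Δ R] [DeltaRing Δ S] [DeltaRing Δ T] {g : S →+* T} {f : R →+* S}
    (hg : IsDeltaHom Δ g) (hf : IsDeltaHom Δ f) : IsDeltaHom Δ (g.comp f) := fun i x => by
  rw [RingHom.comp_apply, RingHom.comp_apply, hf i x, hg i (f x)]

/-- An ideal is differential if it is stable under all the derivations in `Δ`. -/
def IsDeltaIdeal (Δ : Type*) {R : Type*} [CommRing R] [DeltaRing Δ R] (I : Ideal R) : Prop :=
  ∀ (i : Δ) (x : R), x ∈ I → DeltaRing.der i x ∈ I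

/-- The differential spectrum: the prime differential ideals of `R`, with the Zariski topology,
that is, the topology induced from the prime spectrum of `R`. -/
abbrev DeltaSpec (Δ : Type*) (R : Type*) [CommRing R] [DeltaRing Δ R] : Type _ :=
  {p : PrimeSpectrum R // IsDeltaIdeal Δ p.asIdeal}

/-- The map of differential spectra `q ↦ f⁻¹(q)` given by a differential homomorphism `f`. -/
def DeltaSpec.comap {Δ R S : Type*} [CommRing R] [CommRing S] [DeltaRing Δ R] [DeltaRing Δ S]
    (f : R →+* S) (hf : IsDeltaHom Δ f) (q : DeltaSpec Δ S) : DeltaSpec Δ R :=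
  ⟨PrimeSpectrum.comap f q.1, fun i x hx => by
    have h : f x ∈ q.1.asIdeal := hx
    change f (DeltaRing.der i x) ∈ q.1.asIdeal
    rw [hf i x]
    exact q.2 i _ h⟩

/-- The differential `A`-subalgebra of `B` generated by `t`: the smallest `A`-subalgebra that
contains `t` and is stable under all the derivations in `Δ`. -/
def deltaAdjoin (Δ : Type*) (A : Type*) {B : Type*} [CommRing A] [CommRing B] [Algebra A B]
    [DeltaRing Δ B] (t : Set B) : Subalgebra A B :=
  sInf {S : Subalgebra A B | t ⊆ S ∧ ∀ (i : Δ) (x : B), x ∈ S → DeltaRing.der i x ∈ S}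

/-- `B` is differentially finitely generated over `A`. -/
def DeltaFiniteType (Δ : Type*) (A B : Type*) [CommRing A] [CommRing B] [Algebra A B]
    [DeltaRing Δ B] : Prop :=
  ∃ t : Finset B, deltaAdjoin Δ A (t : Set B) = ⊤

namespace DeltaLocalization

variable {R : Type*} [CommRing R] (M : Submonoid R) (L : Type*) [CommRing L] [Algebra R L]
  [IsLocalization M L] (D : Derivation ℤ R R)

/-- The ring homomorphism `x ↦ x + D(x) ε` from `R` to the dual numbers over `L`. -/
def toDual {R : Type*} [CommRing R] (L : Type*) [CommRing L] [Algebra R L]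
    (D : Derivation ℤ R R) : R →+* TrivSqZeroExt L L where
  toFun x := TrivSqZeroExt.inl (algebraMap R L x) + TrivSqZeroExt.inr (algebraMap R L (D x))
  map_one' := by ext <;> simp
  map_zero' := by ext <;> simp
  map_add' x y := by ext <;> simp [Algebra.smul_def (A := L)]
  map_mul' x y := by ext <;> simp [Algebra.smul_def (A := L), mul_comm]

theorem isUnit_toDual (m : M) : IsUnit (toDual L D m) :=
  TrivSqZeroExt.isUnit_iff_isUnit_fst.2 (by
    simpa [toDual] using IsLocalization.map_units L m)

/-- The extension of `toDual` to the localization `L = M⁻¹R`; its `ε`-part is the derivation that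
extends `D`. -/
noncomputable def lift : L →+* TrivSqZeroExt L L :=
  IsLocalization.lift (isUnit_toDual M L D)

theorem lift_algebraMap (x : R) : lift M L D (algebraMap R L x) = toDual L D x :=
  IsLocalization.lift_eq _ _

theorem fst_lift (x : L) : (lift M L D x).fst = x := by
  have h : (TrivSqZeroExt.fstHom ℤ L L).toRingHom.comp (lift M L D) = RingHom.id _ := by
    refine IsLocalization.ringHom_ext M (RingHom.ext fun r => ?_)
    change (lift M L D (algebraMap R L r)).fst = algebraMap R L r
    rw [lift_algebraMap]
    simp [toDual]
  exact RingHom.congr_fun h x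

/-- The derivation of `L = M⁻¹R` that extends the derivation `D` of `R`. -/
noncomputable def der : Derivation ℤ L L :=
  Derivation.mk'
    (AddMonoidHom.toIntLinearMap
      { toFun := fun x => (lift M L D x).snd
        map_zero' := by simp
        map_add' := fun x y => by simp })
    (fun a b => by
      change (lift M L D (a * b)).snd = a • (lift M L D b).snd + b • (lift M L D a).snd
      rw [map_mul, TrivSqZeroExt.snd_mul, fst_lift, fst_lift, op_smul_eq_smul])

theorem der_algebraMap (x : R) : der M L D (algebraMap R L x) = algebraMap R L (D x) := by
  change (lift M L D (algebraMap R L x)).snd = _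
  rw [lift_algebraMap]
  simp [toDual, Algebra.smul_def (A := L)]

/-- Two derivations of `L = M⁻¹R` that agree on the image of `R` are equal. -/
theorem der_ext {R : Type*} [CommRing R] (M : Submonoid R) {L : Type*} [CommRing L] [Algebra R L]
    [IsLocalization M L] {D₁ D₂ : Derivation ℤ L L}
    (h : ∀ x : R, D₁ (algebraMap R L x) = D₂ (algebraMap R L x)) : D₁ = D₂ := by
  ext z
  obtain ⟨x, m, rfl⟩ := IsLocalization.exists_mk'_eq M z
  have hu := IsLocalization.map_units L m
  have e := IsLocalization.mk'_spec L x m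
  have e₁ := congrArg D₁ e
  have e₂ := congrArg D₂ e
  rw [Derivation.leibniz, h, h] at e₁
  rw [Derivation.leibniz, ← e₁] at e₂
  have e₃ := add_left_cancel e₂
  simp only [smul_eq_mul] at e₃
  exact (hu.mul_left_cancel e₃).symm

/-- The structure of differential ring on `L = M⁻¹R` given by the extended derivations. -/
noncomputable abbrev deltaRing (Δ : Type*) [DeltaRing Δ R] : DeltaRing Δ L where
  der i := der M L (DeltaRing.der i)
  der_comm i j x := by
    have h : ⁅der M L (DeltaRing.der i), der M L (DeltaRing.der j)⁆ = 0 :=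
      der_ext M fun r => by
        rw [Derivation.commutator_apply]
        simp only [der_algebraMap, DeltaRing.der_comm i j r, sub_self,
          Derivation.coe_zero, Pi.zero_apply]
    have h' := DFunLike.congr_fun h x
    rw [Derivation.commutator_apply] at h'
    exact sub_eq_zero.1 h'

end DeltaLocalization

/-- The localization `M⁻¹R` of a differential ring, with the derivations extended from `R`. -/
noncomputable instance Localization.instDeltaRing {Δ R : Type*} [CommRing R] [DeltaRing Δ R]
    (M : Submonoid R) : DeltaRing Δ (Localization M) :=
  DeltaLocalization.deltaRing M (Localization M) Δ

theorem isDeltaHom_algebraMap_localization (Δ : Type*) {R : Type*} [CommRing R] [DeltaRing Δ R]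
    (M : Submonoid R) : IsDeltaHom Δ (algebraMap R (Localization M)) := fun i x =>
  (DeltaLocalization.der_algebraMap M (Localization M) (DeltaRing.der i) x).symm

/-! It suffices to make the map of full prime spectra open. Minimal primes over a differential ideal
of a `ℚ`-algebra are differential, so if a prime `q` in an open set lies over a differential prime
`p`, a minimal prime over the extension of `p` contained in `q` is differential, stays in the open
set and still lies over `p` (`DeltaSpec.isOpenMap_comap`).

For full spectra, well-order the derivatives `u a` of the generators compatibly with the
derivations, and single out the set `L` of those `a` with `u a` algebraic over the `u c`, `c < a`.
The `u a` with `a ∉ L` are algebraically independent. `L` is closed under derivation, so by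
Dickson's lemma it consists of derivatives of a finite subset `F`. Differentiating a minimal
equation of `u a` shows that its separant `s` is nonzero and that `s * u b` is a polynomial in lower
elements for every proper derivative `b` of `a` (`exists_separant`, `separant_mul_mem`). Once the
separants of `F` are inverted, `B` therefore agrees with a polynomial ring over `A` to which
finitely many elements are adjoined. Each such step is generically open, and generic openness
composes (`GenericallyOpen.trans`). -/

/-! ### Generic openness and its composition -/

/-- The map `Spec S → Spec R` sends every open set on which `t` does not vanish to an open set. -/
def OpenAway (R S : Type*) [CommRing R] [CommRing S] [Algebra R S] (t : S) : Prop :=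
  ∀ U : Set (PrimeSpectrum S), IsOpen U → U ⊆ PrimeSpectrum.basicOpen t →
    IsOpen (PrimeSpectrum.comap (algebraMap R S) '' U)

/-- The map `Spec S → Spec R` is open on some principal open set `D(t)` with `t ≠ 0`. -/
def GenericallyOpen (R S : Type*) [CommRing R] [CommRing S] [Algebra R S] : Prop :=
  ∃ t : S, t ≠ 0 ∧ OpenAway R S t

theorem GenericallyOpen.of_isOpenMap {R S : Type*} [CommRing R] [CommRing S] [Algebra R S]
    [Nontrivial S] (h : IsOpenMap (PrimeSpectrum.comap (algebraMap R S))) :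
    GenericallyOpen R S :=
  ⟨1, one_ne_zero, fun U hU _ => h U hU⟩

theorem GenericallyOpen.trans {R S T : Type*} [CommRing R] [CommRing S] [CommRing T]
    [Algebra R S] [Algebra S T] [Algebra R T] [IsScalarTower R S T] [IsDomain T]
    (hST : Function.Injective (algebraMap S T))
    (h₁ : GenericallyOpen R S) (h₂ : GenericallyOpen S T) : GenericallyOpen R T := by
  obtain ⟨t, ht, h₁⟩ := h₁
  obtain ⟨u, hu, h₂⟩ := h₂
  refine ⟨u * algebraMap S T t, mul_ne_zero hu ((map_ne_zero_iff _ hST).2 ht), fun U hU hs => ?_⟩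
  rw [IsScalarTower.algebraMap_eq R S T, PrimeSpectrum.comap_comp, Set.image_comp]
  refine h₁ _ (h₂ U hU (hs.trans (PrimeSpectrum.basicOpen_mul_le_left _ _))) ?_
  rintro _ ⟨q, hq, rfl⟩
  exact PrimeSpectrum.basicOpen_mul_le_right u (algebraMap S T t) (hs hq)

theorem OpenAway.of_localization {R S : Type*} [CommRing R] [CommRing S] [Algebra R S] {t : S}
    (L : Type*) [CommRing L] [Algebra S L] [IsLocalization.Away t L]
    (h : IsOpenMap (PrimeSpectrum.comap ((algebraMap S L).comp (algebraMap R S)))) :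
    OpenAway R S t := fun U hU hs => by
  have he := PrimeSpectrum.localization_away_isOpenEmbedding L t
  have : U = PrimeSpectrum.comap (algebraMap S L) '' (PrimeSpectrum.comap (algebraMap S L) ⁻¹' U) :=
    (Set.image_preimage_eq_of_subset
      (hs.trans (PrimeSpectrum.localization_away_comap_range L t).ge)).symm
  rw [this, ← Set.image_comp, ← PrimeSpectrum.comap_comp]
  exact h _ (hU.preimage he.continuous)

theorem OpenAway.isOpenMap {R S : Type*} [CommRing R] [CommRing S] [Algebra R S] {t : S}
    (h : OpenAway R S t) (L : Type*) [CommRing L] [Algebra S L] [IsLocalization.Away t L] :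
    IsOpenMap (PrimeSpectrum.comap ((algebraMap S L).comp (algebraMap R S))) := fun U hU => by
  rw [PrimeSpectrum.comap_comp, Set.image_comp]
  refine h _ ((PrimeSpectrum.localization_away_isOpenEmbedding L t).isOpenMap U hU) ?_
  rw [← PrimeSpectrum.localization_away_comap_range L t]
  exact Set.image_subset_range _ _

theorem GenericallyOpen.of_algEquiv {R S T : Type*} [CommRing R] [CommRing S] [CommRing T]
    [Algebra R S] [Algebra R T] (e : S ≃ₐ[R] T) [Nontrivial T]
    (h : IsOpenMap (PrimeSpectrum.comap (algebraMap R S))) : GenericallyOpen R T := by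
  refine .of_isOpenMap ?_
  rw [← e.toAlgHom.comp_algebraMap, PrimeSpectrum.comap_comp]
  exact h.comp (PrimeSpectrum.homeomorphOfRingEquiv e.toRingEquiv).symm.isOpenMap

/-! ### Generic openness of simple, polynomial and finitely generated extensions -/

/-- An algebraic element is a zero of a nonzero polynomial of minimal degree. -/
theorem IsAlgebraic.exists_minimal {R S : Type*} [CommRing R] [CommRing S] [Algebra R S] {x : S}
    (hx : IsAlgebraic R x) : ∃ p : Polynomial R, p ≠ 0 ∧ Polynomial.aeval x p = 0 ∧
      ∀ q : Polynomial R, q.natDegree < p.natDegree → Polynomial.aeval x q = 0 → q = 0 := by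
  obtain ⟨p, ⟨hp, hp'⟩, hmin⟩ := WellFounded.has_min (measure (Polynomial.natDegree (R := R))).wf
    {p | p ≠ 0 ∧ Polynomial.aeval x p = 0} hx
  exact ⟨p, hp, hp', fun q hq hq' => by_contra fun h => hmin q ⟨h, hq'⟩ hq⟩

-- Inverting the leading coefficient `a` of a polynomial of minimal degree killing `x` turns `S`
-- into `R_a[X]/(g)` with `g` monic: a remainder modulo `g` that vanishes at `x` is zero by
-- minimality. This ring is free of finite rank over `R_a`, hence flat and finitely presented over
-- `R`, so going-down makes the map open.
open Polynomial in
theorem genericallyOpen_of_isAlgebraic {R S : Type*} [CommRing R] [CommRing S] [Algebra R S]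
    [IsDomain S] (hinj : Function.Injective (algebraMap R S)) {x : S} (hx : IsAlgebraic R x)
    (hgen : Algebra.adjoin R {x} = ⊤) : GenericallyOpen R S := by
  have : IsDomain R := hinj.isDomain
  obtain ⟨p, hp, hpx, hmin⟩ := hx.exists_minimal
  set a := p.leadingCoeff with ha
  have ha0 : a ≠ 0 := leadingCoeff_ne_zero.2 hp
  have ha0' : algebraMap R S a ≠ 0 := (map_ne_zero_iff _ hinj).2 ha0
  refine ⟨algebraMap R S a, ha0', ?_⟩
  let L := Localization.Away (algebraMap R S a)
  let K := Localization.Away a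
  refine .of_localization L ?_
  have hKinj : Function.Injective (algebraMap R K) :=
    IsLocalization.injective K (powers_le_nonZeroDivisors_of_noZeroDivisors ha0)
  have hLinj : Function.Injective (algebraMap S L) :=
    IsLocalization.injective L (powers_le_nonZeroDivisors_of_noZeroDivisors ha0')
  have hu : IsUnit (((algebraMap S L).comp (algebraMap R S)) a) :=
    IsLocalization.Away.algebraMap_isUnit (algebraMap R S a)
  let j : K →+* L := IsLocalization.Away.lift a hu
  have hj : j.comp (algebraMap R K) = (algebraMap S L).comp (algebraMap R S) :=
    IsLocalization.Away.lift_comp a hu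
  let b : K := IsLocalization.Away.invSelf a
  have hab : algebraMap R K a * b = 1 := IsLocalization.Away.mul_invSelf a
  let y : L := algebraMap S L x
  have heval : ∀ q : R[X], (q.map (algebraMap R K)).eval₂ j y = algebraMap S L (aeval x q) := by
    intro q
    rw [eval₂_map, hj, aeval_def, hom_eval₂]
  have hK : IsDomain K := IsLocalization.isDomain_localization
    (powers_le_nonZeroDivisors_of_noZeroDivisors ha0)
  let g : K[X] := C b * p.map (algebraMap R K)
  have hg : g.Monic := by
    refine monic_C_mul_of_mul_leadingCoeff_eq_one ?_
    rw [leadingCoeff_map_of_injective hKinj, mul_comm, hab]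
  have hgdeg : g.natDegree = p.natDegree := by
    have hb : b ≠ 0 := right_ne_zero_of_mul_eq_one hab
    rw [natDegree_C_mul hb, natDegree_map_eq_of_injective hKinj]
  have hgy : g.eval₂ j y = 0 := by
    rw [eval₂_mul, heval, hpx, map_zero, mul_zero]
  have hmin' : ∀ r : K[X], r.natDegree < p.natDegree → r.eval₂ j y = 0 → r = 0 := by
    intro r hr hry
    -- Clearing denominators brings `r` back to `R[X]`, where minimality of `p` applies.
    obtain ⟨c, hc, hcr⟩ := IsLocalization.integerNormalization_spec (Submonoid.powers a) r
    set q := IsLocalization.integerNormalization (Submonoid.powers a) r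
    have hcr' : q.map (algebraMap R K) = C (algebraMap R K c) * r := by
      rw [hcr, ← smul_eq_C_mul, algebraMap_smul]
    have hq : q = 0 := by
      refine hmin q ?_ (hLinj ?_)
      · rw [← natDegree_map_eq_of_injective hKinj, hcr']
        exact (natDegree_C_mul_le _ _).trans_lt hr
      · rw [← heval, hcr', eval₂_mul, hry, mul_zero, map_zero]
    rw [hq, Polynomial.map_zero, eq_comm, mul_eq_zero, C_eq_zero] at hcr'
    exact hcr'.resolve_left (IsLocalization.map_units K ⟨c, hc⟩).ne_zero
  let ψ : AdjoinRoot g →+* L := AdjoinRoot.lift j y hgy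
  have hψinj : Function.Injective ψ := by
    rw [injective_iff_map_eq_zero]
    intro z hz
    obtain ⟨h, rfl⟩ := AdjoinRoot.mk_surjective z
    have h1 : AdjoinRoot.mk g h = AdjoinRoot.mk g (h %ₘ g) := by
      rw [AdjoinRoot.mk_eq_mk]
      exact ⟨h /ₘ g, by rw [sub_eq_iff_eq_add', modByMonic_add_div h]⟩
    rw [h1, AdjoinRoot.lift_mk] at hz
    rw [h1]
    by_cases h0 : g.natDegree = 0
    · rw [hg.natDegree_eq_zero.1 h0, modByMonic_one, map_zero]
    · rw [hmin' _ (hgdeg ▸ natDegree_modByMonic_lt h hg (fun h => h0 (by simp [h]))) hz, map_zero]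
  have hψsurj : Function.Surjective ψ := by
    have hψof : ∀ r : R, ψ (AdjoinRoot.of g (algebraMap R K r)) =
        algebraMap S L (algebraMap R S r) := fun r => by
      rw [AdjoinRoot.lift_of]
      exact RingHom.congr_fun hj r
    intro z
    obtain ⟨d, ⟨_, k, rfl⟩, rfl⟩ :=
      IsLocalization.exists_mk'_eq (Submonoid.powers (algebraMap R S a)) z
    have hd : d ∈ Algebra.adjoin R {x} := hgen ▸ Algebra.mem_top
    rw [Algebra.adjoin_singleton_eq_range_aeval] at hd
    obtain ⟨q, rfl⟩ := hd
    refine ⟨AdjoinRoot.mk g (q.map (algebraMap R K)) * AdjoinRoot.of g b ^ k, ?_⟩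
    rw [eq_comm, IsLocalization.mk'_eq_iff_eq_mul, map_mul, AdjoinRoot.lift_mk, heval, mul_assoc]
    simp only [map_pow]
    rw [← hψof, ← mul_pow, ← map_mul, ← map_mul, mul_comm b, hab]
    simp
  have hfree : Module.Free K (AdjoinRoot g) := .of_basis (AdjoinRoot.powerBasis' hg).basis
  have hfin : Module.Finite K (AdjoinRoot g) := (AdjoinRoot.powerBasis' hg).finite
  have hflat : Module.Flat R (AdjoinRoot g) := by
    have : Module.Flat R K := IsLocalization.flat K (Submonoid.powers a)
    exact .trans R K _
  have hfp : Algebra.FinitePresentation R (AdjoinRoot g) := by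
    have : Algebra.FinitePresentation R K := IsLocalization.Away.finitePresentation a
    exact .trans R K _
  have hopen : IsOpenMap (PrimeSpectrum.comap (algebraMap R (AdjoinRoot g))) :=
    PrimeSpectrum.isOpenMap_comap_of_hasGoingDown_of_finitePresentation
  have hcomp : (algebraMap S L).comp (algebraMap R S) = ψ.comp (algebraMap R (AdjoinRoot g)) := by
    rw [← hj, IsScalarTower.algebraMap_eq R K (AdjoinRoot g), ← RingHom.comp_assoc]
    congr 1
    ext r
    exact (AdjoinRoot.lift_of hgy).symm
  rw [hcomp, PrimeSpectrum.comap_comp]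
  exact hopen.comp
    (PrimeSpectrum.homeomorphOfRingEquiv (RingEquiv.ofBijective ψ ⟨hψinj, hψsurj⟩)).symm.isOpenMap

theorem genericallyOpen_of_transcendental {R S : Type*} [CommRing R] [CommRing S] [Algebra R S]
    [IsDomain S] {x : S} (hx : Transcendental R x)
    (hgen : Algebra.adjoin R {x} = ⊤) : GenericallyOpen R S := by
  refine .of_algEquiv (AlgEquiv.ofBijective (Polynomial.aeval (R := R) x)
    ⟨transcendental_iff_injective.1 hx, ?_⟩) Polynomial.isOpenMap_comap_C
  rw [← AlgHom.range_eq_top, ← Algebra.adjoin_singleton_eq_range_aeval, hgen]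

/-- The index type may be infinite: polynomial rings in any number of variables have open structure
map. -/
theorem genericallyOpen_of_algebraicIndependent {ι R S : Type*} [CommRing R] [CommRing S]
    [Algebra R S] [IsDomain S] {x : ι → S} (hx : AlgebraicIndependent R x) :
    GenericallyOpen R (Algebra.adjoin R (Set.range x)) :=
  .of_algEquiv hx.aevalEquiv MvPolynomial.isOpenMap_comap_C

theorem genericallyOpen_adjoin_singleton {R S : Type*} [CommRing R] [CommRing S] [Algebra R S]
    [IsDomain S] (hinj : Function.Injective (algebraMap R S)) (x : S) :
    GenericallyOpen R (Algebra.adjoin R {x}) := by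
  let y : Algebra.adjoin R {x} := ⟨x, Algebra.subset_adjoin rfl⟩
  have hgen : Algebra.adjoin R {y} = ⊤ := by
    rw [← Algebra.adjoin_adjoin_coe_preimage]
    congr 1
    ext z
    simp [y, Subtype.ext_iff]
  by_cases hy : IsAlgebraic R y
  · exact genericallyOpen_of_isAlgebraic
      (fun a b h => hinj (congrArg (Subtype.val : Algebra.adjoin R {x} → S) h)) hy hgen
  · exact genericallyOpen_of_transcendental hy hgen

theorem GenericallyOpen.adjoin_singleton {R S : Type*} [CommRing R] [CommRing S] [Algebra R S]
    [IsDomain S] {T : Subalgebra R S} (h : GenericallyOpen R T) (x : S) :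
    GenericallyOpen R ((Algebra.adjoin T {x}).restrictScalars R) := by
  have h' := genericallyOpen_adjoin_singleton (R := T) Subtype.val_injective x
  let U : Subalgebra R S := (Algebra.adjoin T {x}).restrictScalars R
  let : Algebra T U := Subalgebra.algebra (Algebra.adjoin T {x})
  have : IsScalarTower R T U := .of_algebraMap_eq fun _ => rfl
  exact GenericallyOpen.trans (S := T) (T := U)
    (fun a b h => Subtype.ext (congrArg (Subtype.val : U → S) h)) h h'

theorem GenericallyOpen.adjoin_union_finset {R S : Type*} [CommRing R] [CommRing S] [Algebra R S]
    [IsDomain S] {X : Set S} (h : GenericallyOpen R (Algebra.adjoin R X)) (F : Finset S) :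
    GenericallyOpen R (Algebra.adjoin R (X ∪ F)) := by
  classical
  induction F using Finset.induction_on with
  | empty => rwa [Finset.coe_empty, Set.union_empty]
  | insert x F _ ih =>
    rw [Finset.coe_insert, Set.insert_eq, Set.union_comm {x}, ← Set.union_assoc,
      Algebra.adjoin_union_eq_adjoin_adjoin]
    exact ih.adjoin_singleton x

/-- The hypothesis says that `T` and `S` have the same localization at `s`, so `D(s)` in `Spec S`
maps onto an open subscheme of `Spec T`. -/
theorem genericallyOpen_of_exists_pow_mul_mem {R S : Type*} [CommRing R] [CommRing S] [Algebra R S]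
    [IsDomain S] (T : Subalgebra R S) {s : S} (hs : s ∈ T) (hs0 : s ≠ 0)
    (h : ∀ b : S, ∃ n : ℕ, s ^ n * b ∈ T) : GenericallyOpen T S := by
  refine ⟨s, hs0, .of_localization (Localization.Away s) ?_⟩
  let L := Localization.Away s
  have hL : Function.Injective (algebraMap S L) :=
    IsLocalization.injective L (powers_le_nonZeroDivisors_of_noZeroDivisors hs0)
  have hloc : IsLocalization.Away (⟨s, hs⟩ : T) L := by
    refine (isLocalization_iff _ _).2 ⟨?_, fun z => ?_, fun {x y} hxy => ⟨1, ?_⟩⟩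
    · rintro ⟨_, n, rfl⟩
      rw [map_pow]
      exact (IsLocalization.Away.algebraMap_isUnit (S := L) s).pow n
    · obtain ⟨b, ⟨_, k, rfl⟩, rfl⟩ := IsLocalization.exists_mk'_eq (Submonoid.powers s) z
      obtain ⟨n, hn⟩ := h b
      refine ⟨(⟨_, hn⟩, ⟨_, n + k, rfl⟩), ?_⟩
      change IsLocalization.mk' L b _ * algebraMap S L (s ^ (n + k)) = algebraMap S L (s ^ n * b)
      rw [pow_add, map_mul, map_mul, mul_left_comm]
      congr 1
      exact IsLocalization.mk'_spec L b _
    · rw [Subtype.ext (hL hxy)]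
  exact (PrimeSpectrum.localization_away_isOpenEmbedding L (⟨s, hs⟩ : T)).isOpenMap

theorem IsAlgebraic.of_subalgebra_le {R S : Type*} [CommRing R] [CommRing S] [Algebra R S]
    {T T' : Subalgebra R S} (h : T ≤ T') {x : S} (hx : IsAlgebraic T x) : IsAlgebraic T' x := by
  obtain ⟨p, hp, hpx⟩ := hx
  have hinj : Function.Injective (Subalgebra.inclusion h).toRingHom :=
    Subalgebra.inclusion_injective h
  refine ⟨p.map (Subalgebra.inclusion h).toRingHom,
    (Polynomial.map_ne_zero_iff hinj).2 hp, ?_⟩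
  rw [Polynomial.aeval_def, Polynomial.eval₂_map]
  exact hpx

/-- A relation involves finitely many elements; a finite set is built by adding its maximum last,
which is transcendental over all the earlier ones. -/
theorem algebraicIndepOn_of_transcendental_Iio {ι R S : Type*} [CommRing R] [CommRing S]
    [Algebra R S] [LinearOrder ι] (hinj : Function.Injective (algebraMap R S)) {x : ι → S}
    {s : Set ι} (h : ∀ i ∈ s, Transcendental (Algebra.adjoin R (x '' Set.Iio i)) (x i)) :
    AlgebraicIndepOn R x s := by
  have hfin : ∀ t : Finset ι, (t : Set ι) ⊆ s → AlgebraicIndepOn R x (t : Set ι) := by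
    intro t
    induction t using Finset.induction_on_max with
    | empty =>
      intro _
      rw [Finset.coe_empty]
      exact algebraicIndependent_empty_type_iff.2 hinj
    | insert i t hi ih =>
      intro hs
      rw [Finset.coe_insert] at hs ⊢
      refine (ih ((Set.subset_insert _ _).trans hs)).insert fun hx => h i (hs (.inl rfl)) ?_
      exact hx.of_subalgebra_le (Algebra.adjoin_mono (Set.image_mono hi))
  refine algebraicIndependent_of_finite_type fun t ht => ?_
  have h' : AlgebraicIndepOn R x (Subtype.val '' t) := by
    have h := hfin (ht.image Subtype.val).toFinset
    rw [Set.Finite.coe_toFinset] at h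
    exact h (Subtype.coe_image_subset s t)
  let e : t → (Subtype.val '' t : Set ι) := fun i => ⟨i.1.1, Set.mem_image_of_mem _ i.2⟩
  exact h'.comp e fun i j hij => Subtype.ext (Subtype.ext (congrArg (fun z => z.1) hij :))

/-! ### Derivations on generated subalgebras -/

section Derivation

variable {A B : Type*} [CommRing A] [CommRing B] [Algebra A B] {D : Derivation ℤ B B}

theorem Derivation.apply_mem_adjoin {S : Set B} {T : Subalgebra A B}
    (hA : ∀ a : A, D (algebraMap A B a) ∈ T) (hST : S ⊆ T) (hS : ∀ x ∈ S, D x ∈ T) {y : B}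
    (hy : y ∈ Algebra.adjoin A S) : D y ∈ T := by
  have hle : Algebra.adjoin A S ≤ T := Algebra.adjoin_le hST
  induction hy using Algebra.adjoin_induction with
  | mem x hx => exact hS x hx
  | algebraMap r => exact hA r
  | add x y _ _ hx hy => rw [map_add]; exact T.add_mem hx hy
  | mul x y hx' hy' hx hy =>
    rw [D.leibniz]
    exact T.add_mem (T.mul_mem (hle hx') hy) (T.mul_mem (hle hy') hx)

/-- The difference is the value at `x` of the polynomial obtained by applying `D` to the
coefficients of `p`. -/
theorem Derivation.apply_aeval_sub_mem {T T' : Subalgebra A B}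
    (hT : ∀ y ∈ T, D y ∈ T') {x : B} (hx : x ∈ T') (p : Polynomial T) :
    D (Polynomial.aeval x p) - Polynomial.aeval x p.derivative * D x ∈ T' := by
  induction p using Polynomial.induction_on' with
  | add p q hp hq =>
    convert T'.add_mem hp hq using 1
    simp only [map_add]
    ring
  | monomial n c =>
    have : D (Polynomial.aeval x (Polynomial.monomial n c)) -
        Polynomial.aeval x (Polynomial.monomial n c).derivative * D x = x ^ n * D c := by
      rw [Polynomial.derivative_monomial, Polynomial.aeval_monomial, Polynomial.aeval_monomial,
        D.leibniz, D.leibniz_pow]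
      simp only [Subalgebra.algebraMap_def, smul_eq_mul, nsmul_eq_mul, map_mul,
        SubringClass.coe_natCast]
      simp
      ring
    rw [this]
    exact T'.mul_mem (T'.pow_mem hx n) (hT c c.2)

end Derivation

/-! ### Rankings and separants -/

section Ranking

variable {Δ A B I : Type*} [CommRing A] [CommRing B] [Algebra A B] [DeltaRing Δ A] [DeltaRing Δ B]
  {σ : Δ → I → I} {u : I → B}

theorem der_mem_adjoin (hdiff : IsDeltaHom Δ (algebraMap A B))
    (hu : ∀ i a, u (σ i a) = DeltaRing.der i (u a)) {i : Δ} {X Y : Set I} (hXY : X ⊆ Y)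
    (hσ : ∀ a ∈ X, σ i a ∈ Y) {y : B} (hy : y ∈ Algebra.adjoin A (u '' X)) :
    DeltaRing.der i y ∈ Algebra.adjoin A (u '' Y) := by
  refine Derivation.apply_mem_adjoin (fun a => ?_)
    ((Set.image_mono hXY).trans Algebra.subset_adjoin) ?_ hy
  · rw [← hdiff i a]
    exact Subalgebra.algebraMap_mem _ _
  · rintro _ ⟨a, ha, rfl⟩
    rw [← hu]
    exact Algebra.subset_adjoin ⟨_, hσ a ha, rfl⟩

variable [LinearOrder I]

/-- The separant of an element that is algebraic over the elements of lower rank. -/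
theorem exists_separant [IsDomain B] [CharZero B] (hdiff : IsDeltaHom Δ (algebraMap A B))
    (hσ : ∀ i, StrictMono (σ i)) (hlt : ∀ i a, a < σ i a)
    (hu : ∀ i a, u (σ i a) = DeltaRing.der i (u a)) {a : I}
    (ha : IsAlgebraic (Algebra.adjoin A (u '' Set.Iio a)) (u a)) :
    ∃ s ∈ Algebra.adjoin A (u '' Set.Iic a), s ≠ 0 ∧
      ∀ i, s * u (σ i a) ∈ Algebra.adjoin A (u '' Set.Iio (σ i a)) := by
  obtain ⟨p, hp, hpx, hmin⟩ := ha.exists_minimal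
  have hle : Algebra.adjoin A (u '' Set.Iio a) ≤ Algebra.adjoin A (u '' Set.Iic a) :=
    Algebra.adjoin_mono (Set.image_mono Set.Iio_subset_Iic_self)
  have hdeg : p.natDegree ≠ 0 := by
    intro h0
    rw [Polynomial.eq_C_of_natDegree_eq_zero h0, Polynomial.aeval_C] at hpx
    rw [Polynomial.eq_C_of_natDegree_eq_zero h0, Polynomial.C_ne_zero] at hp
    exact hp (Subtype.ext hpx)
  -- Characteristic zero enters here: a nonconstant polynomial has nonzero derivative.
  have hder : p.derivative ≠ 0 := fun h =>
    hdeg (Polynomial.derivative_eq_zero.1 h)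
  refine ⟨Polynomial.aeval (u a) p.derivative, ?_, fun h =>
    hder (hmin _ (Polynomial.natDegree_derivative_lt hdeg) h), fun i => ?_⟩
  · rw [Polynomial.aeval_eq_sum_range]
    refine Subalgebra.sum_mem _ fun k _ => ?_
    rw [Algebra.smul_def]
    exact Subalgebra.mul_mem _ (hle (p.derivative.coeff k).2)
      (Subalgebra.pow_mem _ (Algebra.subset_adjoin (Set.mem_image_of_mem u Set.self_mem_Iic)) k)
  · have h := Derivation.apply_aeval_sub_mem (D := DeltaRing.der i)
      (T' := Algebra.adjoin A (u '' Set.Iio (σ i a)))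
      (fun y hy => der_mem_adjoin hdiff hu (Set.Iio_subset_Iio (hlt i a).le)
        (fun b hb => hσ i hb) hy)
      (Algebra.subset_adjoin (Set.mem_image_of_mem u (hlt i a))) p
    rw [hpx, map_zero, zero_sub] at h
    rw [hu]
    exact neg_mem_iff.1 h

/-- Differentiating `s * u b` gives `s * u (σ i b)` plus `u b` times the derivative of `s`; as `a <
b`, that second term only involves elements below `σ i b`. -/
theorem separant_mul_mem (hdiff : IsDeltaHom Δ (algebraMap A B))
    (hσ : ∀ i, StrictMono (σ i)) (hlt : ∀ i a, a < σ i a)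
    (hu : ∀ i a, u (σ i a) = DeltaRing.der i (u a)) {a : I} {s : B}
    (hs : s ∈ Algebra.adjoin A (u '' Set.Iic a))
    (hsu : ∀ i, s * u (σ i a) ∈ Algebra.adjoin A (u '' Set.Iio (σ i a))) {b : I}
    (hb : Relation.TransGen (fun a b => ∃ i, b = σ i a) a b) :
    a < b ∧ s * u b ∈ Algebra.adjoin A (u '' Set.Iio b) := by
  induction hb with
  | single h =>
    obtain ⟨i, rfl⟩ := h
    exact ⟨hlt i a, hsu i⟩
  | @tail b c _ h ih =>
    obtain ⟨i, rfl⟩ := h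
    obtain ⟨hab, ih⟩ := ih
    refine ⟨hab.trans (hlt i b), ?_⟩
    have h1 := der_mem_adjoin (i := i) hdiff hu (Set.Iio_subset_Iio (hlt i b).le)
      (fun c hc => hσ i hc) ih
    have h2 : DeltaRing.der i s ∈ Algebra.adjoin A (u '' Set.Iio (σ i b)) :=
      der_mem_adjoin hdiff hu (Set.Iic_subset_Iio.2 (hab.trans (hlt i b)))
        (fun c hc => hσ i (lt_of_le_of_lt (Set.mem_Iic.1 hc) hab)) hs
    have h3 : u b ∈ Algebra.adjoin A (u '' Set.Iio (σ i b)) :=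
      Algebra.subset_adjoin (Set.mem_image_of_mem u (hlt i b))
    rw [Derivation.leibniz, ← hu, smul_eq_mul, smul_eq_mul] at h1
    have h4 := Subalgebra.sub_mem _ h1 (Subalgebra.mul_mem _ h3 h2)
    rwa [add_sub_cancel_right] at h4

theorem genericallyOpen_of_ranking [WellFoundedLT I] [IsDomain B] [CharZero B]
    (hinj : Function.Injective (algebraMap A B)) (hdiff : IsDeltaHom Δ (algebraMap A B))
    (hσ : ∀ i, StrictMono (σ i)) (hlt : ∀ i a, a < σ i a)
    (hfin : ∀ L : Set I, (∀ i, ∀ a ∈ L, σ i a ∈ L) → ∃ F : Finset I, (F : Set I) ⊆ L ∧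
      ∀ b ∈ L, ∃ a ∈ F, Relation.ReflTransGen (fun a b => ∃ i, b = σ i a) a b)
    (hu : ∀ i a, u (σ i a) = DeltaRing.der i (u a))
    (hgen : Algebra.adjoin A (Set.range u) = ⊤) : GenericallyOpen A B := by
  classical
  let L : Set I := {a | IsAlgebraic (Algebra.adjoin A (u '' Set.Iio a)) (u a)}
  have hsep : ∀ a : L, _ := fun a => exists_separant hdiff hσ hlt hu a.2
  choose s hs hs0 hsu using hsep
  have hL : ∀ i, ∀ a ∈ L, σ i a ∈ L := by
    intro i a ha
    have hle : Algebra.adjoin A (u '' Set.Iic a) ≤ Algebra.adjoin A (u '' Set.Iio (σ i a)) :=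
      Algebra.adjoin_mono (Set.image_mono fun c hc => lt_of_le_of_lt hc (hlt i a))
    let c : Algebra.adjoin A (u '' Set.Iio (σ i a)) := ⟨_, hle (hs ⟨a, ha⟩)⟩
    let d : Algebra.adjoin A (u '' Set.Iio (σ i a)) := ⟨_, hsu ⟨a, ha⟩ i⟩
    have hc : c ≠ 0 := fun h => hs0 ⟨a, ha⟩ (congrArg Subtype.val h)
    -- A derivative of `u a` is a root of a linear polynomial whose leading coefficient is the
    -- separant.
    refine ⟨Polynomial.C c * Polynomial.X - Polynomial.C d, ?_, ?_⟩
    · intro h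
      apply hc
      simpa using congrArg (fun p => p.coeff 1) h
    · simp [c, d]
  obtain ⟨F, hFL, hF⟩ := hfin L hL
  let G : Finset B := F.image u ∪ F.attach.image fun a : F => s ⟨a, hFL a.2⟩
  let T : Subalgebra A B := Algebra.adjoin A (u '' Lᶜ ∪ G)
  have hGT : ∀ x ∈ G, x ∈ T := fun x hx => Algebra.subset_adjoin (.inr hx)
  have hopen : GenericallyOpen A T := by
    refine GenericallyOpen.adjoin_union_finset ?_ G
    rw [Set.image_eq_range]
    exact genericallyOpen_of_algebraicIndependent
      (algebraicIndepOn_of_transcendental_Iio hinj fun i hi => hi)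
  let t : B := ∏ a ∈ F.attach, s ⟨a, hFL a.2⟩
  have hsT : ∀ a : F, s ⟨a, hFL a.2⟩ ∈ T := fun a => hGT _ <|
    Finset.mem_union_right _ (Finset.mem_image_of_mem (fun a : F => s ⟨a, hFL a.2⟩)
      (F.mem_attach a))
  have ht : t ∈ T := Subalgebra.prod_mem _ fun a _ => hsT a
  have ht0 : t ≠ 0 := Finset.prod_ne_zero_iff.2 fun a _ => hs0 _
  let T' : Subalgebra A B :=
    { carrier := {b | ∃ n : ℕ, t ^ n * b ∈ T}
      mul_mem' := by
        rintro x y ⟨m, hm⟩ ⟨n, hn⟩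
        refine ⟨m + n, ?_⟩
        rw [pow_add, mul_mul_mul_comm]
        exact T.mul_mem hm hn
      add_mem' := by
        rintro x y ⟨m, hm⟩ ⟨n, hn⟩
        refine ⟨m + n, ?_⟩
        rw [mul_add, pow_add, mul_right_comm, mul_assoc _ _ y]
        exact T.add_mem (T.mul_mem hm (T.pow_mem ht n)) (T.mul_mem (T.pow_mem ht m) hn)
      algebraMap_mem' := fun r => ⟨0, by
        rw [pow_zero, one_mul]
        exact T.algebraMap_mem r⟩ }
  have hTT' : T ≤ T' := fun x hx => ⟨0, by rwa [pow_zero, one_mul]⟩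
  have huT' : ∀ b, u b ∈ T' := by
    -- Well-founded induction on rank: `t` times a high power carries every `u b` into `T`.
    intro b
    induction b using WellFoundedLT.induction with
    | ind b ih =>
      by_cases hb : b ∈ L
      · obtain ⟨a, ha, hab⟩ := hF b hb
        rcases Relation.reflTransGen_iff_eq_or_transGen.1 hab with rfl | hab
        · exact hTT' (hGT _ (Finset.mem_union_left _ (Finset.mem_image_of_mem u ha)))
        · have hle : Algebra.adjoin A (u '' Set.Iio b) ≤ T' := Algebra.adjoin_le (by
            rintro _ ⟨c, hc, rfl⟩
            exact ih c hc)
          obtain ⟨n, hn⟩ := hle (separant_mul_mem hdiff hσ hlt hu (hs ⟨a, hFL ha⟩)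
            (hsu ⟨a, hFL ha⟩) hab).2
          -- The extra factor `t` supplies the separant of `a`; its remaining factors already lie in
          -- `T`.
          refine ⟨n + 1, ?_⟩
          have : t ^ (n + 1) * u b = (∏ c ∈ F.attach.erase ⟨a, ha⟩, s ⟨c, hFL c.2⟩) *
              (t ^ n * (s ⟨a, hFL ha⟩ * u b)) := by
            have : t = s ⟨a, hFL ha⟩ * ∏ c ∈ F.attach.erase ⟨a, ha⟩, s ⟨c, hFL c.2⟩ :=
              (Finset.mul_prod_erase _ (fun c : F => s ⟨c, hFL c.2⟩) (F.mem_attach ⟨a, ha⟩)).symm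
            rw [pow_succ, mul_assoc]
            nth_rw 2 [this]
            ring
          rw [this]
          exact T.mul_mem (Subalgebra.prod_mem _ fun c _ => hsT c) hn
      · exact hTT' (Algebra.subset_adjoin (.inl ⟨b, hb, rfl⟩))
  have hT' : T' = ⊤ := top_le_iff.1 (hgen ▸ Algebra.adjoin_le (by
    rintro _ ⟨b, rfl⟩
    exact huT' b))
  exact hopen.trans Subtype.val_injective
    (genericallyOpen_of_exists_pow_mul_mem T ht ht0 fun b => (hT' ▸ Algebra.mem_top : b ∈ T'))

end Ranking

/-! ### Minimal primes of differential ideals -/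

theorem Ideal.exists_mul_pow_mem_of_mem_minimalPrimes {R : Type*} [CommRing R] {I q : Ideal R}
    (hq : q ∈ I.minimalPrimes) {x : R} (hx : x ∈ q) : ∃ y ∉ q, ∃ n : ℕ, y * x ^ n ∈ I := by
  have := hq.isPrime
  have h := IsLocalization.AtPrime.radical_map_of_mem_minimalPrimes
    (Localization.AtPrime q) q I hq
  have hx' := Ideal.mem_map_of_mem (algebraMap R (Localization.AtPrime q)) hx
  rw [← h] at hx'
  obtain ⟨n, hn⟩ := hx'
  rw [← map_pow, IsLocalization.algebraMap_mem_map_algebraMap_iff q.primeCompl] at hn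
  obtain ⟨y, hy, hyx⟩ := hn
  exact ⟨y, hy, n, hyx⟩

/-- Starting from `y * x ^ n ∈ I` with `y ∉ q`, each differentiation trades a factor `x` for two
factors `D x`, dividing by an integer along the way. At the end `z * D x ^ l ∈ I` with `z ∉ q`, so
`D x ∈ q`. -/
theorem Derivation.apply_mem_of_mem_minimalPrimes {R : Type*} [CommRing R] [Algebra ℚ R]
    (D : Derivation ℤ R R) {I q : Ideal R} (hI : ∀ x ∈ I, D x ∈ I) (hq : q ∈ I.minimalPrimes)
    {x : R} (hx : x ∈ q) : D x ∈ q := by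
  have hqp := hq.isPrime
  obtain ⟨y, hy, n, hyx⟩ := Ideal.exists_mul_pow_mem_of_mem_minimalPrimes hq hx
  have key : ∀ n k : ℕ, ∀ y ∉ q, y * x ^ n * D x ^ k ∈ I → ∃ z ∉ q, ∃ l : ℕ, z * D x ^ l ∈ I := by
    intro n
    induction n with
    | zero =>
      intro k y hy h
      exact ⟨y, hy, k, by simpa using h⟩
    | succ m ih =>
      intro k y hy h
      refine ih (k + 2) (y ^ 2) (fun h' => hy (hqp.mem_of_pow_mem _ h')) ?_
      -- Multiplying by `y * D x` makes the Leibniz terms containing `D y` and `D (D x)` multiples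
      -- of the element in `h`.
      have h1 := I.mul_mem_left (y * D x) (hI _ h)
      have h2 : (m + 1 : R) * (y ^ 2 * x ^ m * D x ^ (k + 2)) ∈ I := by
        have h3 := I.sub_mem h1 (I.mul_mem_left (D y * D x + k * y * D (D x)) h)
        convert h3 using 1
        rw [D.leibniz, D.leibniz, D.leibniz_pow, D.leibniz_pow]
        rcases k with _ | k
        · simp
          ring
        · simp
          ring
      have h4 := I.mul_mem_left (algebraMap ℚ R (m + 1 : ℚ)⁻¹) h2
      have h5 : algebraMap ℚ R (m + 1 : ℚ)⁻¹ * (m + 1 : R) = 1 := by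
        have : (m + 1 : R) = algebraMap ℚ R (m + 1 : ℚ) := by simp
        rw [this, ← map_mul, inv_mul_cancel₀ (by positivity), map_one]
      rwa [← mul_assoc, h5, one_mul] at h4
  obtain ⟨z, hz, l, hzl⟩ := key n 0 y hy (by simpa using hyx)
  exact hqp.mem_of_pow_mem l ((hqp.mem_or_mem (hq.le hzl)).resolve_left hz)

theorem IsDeltaIdeal.of_mem_minimalPrimes {Δ R : Type*} [CommRing R] [Algebra ℚ R]
    [DeltaRing Δ R] {I q : Ideal R} (hI : IsDeltaIdeal Δ I) (hq : q ∈ I.minimalPrimes) :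
    IsDeltaIdeal Δ q := fun i _ hx =>
  (DeltaRing.der i).apply_mem_of_mem_minimalPrimes (hI i) hq hx

theorem IsDeltaIdeal.map {Δ R S : Type*} [CommRing R] [CommRing S] [DeltaRing Δ R]
    [DeltaRing Δ S] {f : R →+* S} (hf : IsDeltaHom Δ f) {I : Ideal R} (hI : IsDeltaIdeal Δ I) :
    IsDeltaIdeal Δ (I.map f) := by
  intro i x hx
  induction hx using Submodule.span_induction with
  | mem x hx =>
    obtain ⟨a, ha, rfl⟩ := hx
    rw [← hf]
    exact Ideal.mem_map_of_mem f (hI i a ha)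
  | zero => rw [map_zero]; exact zero_mem _
  | add x y _ _ hx hy => rw [map_add]; exact add_mem hx hy
  | smul r x hx' hx =>
    rw [smul_eq_mul, Derivation.leibniz]
    exact add_mem (Ideal.mul_mem_left _ _ hx) (Ideal.mul_mem_right _ _ hx')

/-- If a differential homomorphism to a `ℚ`-algebra induces an open map of prime spectra, then it
induces an open map of differential spectra. -/
theorem DeltaSpec.isOpenMap_comap {Δ R S : Type*} [CommRing R] [CommRing S] [Algebra ℚ S]
    [DeltaRing Δ R] [DeltaRing Δ S] {f : R →+* S} (hf : IsDeltaHom Δ f)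
    (h : IsOpenMap (PrimeSpectrum.comap f)) : IsOpenMap (DeltaSpec.comap f hf) := by
  rintro _ ⟨V, hV, rfl⟩
  have : DeltaSpec.comap f hf '' (Subtype.val ⁻¹' V) =
      Subtype.val ⁻¹' (PrimeSpectrum.comap f '' V) := by
    ext p
    constructor
    · rintro ⟨q, hq, rfl⟩
      exact ⟨q.1, hq, rfl⟩
    · rintro ⟨q, hq, hqp⟩
      have hle : p.1.asIdeal.map f ≤ q.asIdeal := by
        rw [Ideal.map_le_iff_le_comap, ← hqp]
        rfl
      -- Shrinking `q` to `q'` keeps it in `V`, since open sets are stable under generization, and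
      -- its contraction is squeezed between `p` and that of `q`, which is `p`.
      obtain ⟨q', hq', hle'⟩ := Ideal.exists_minimalPrimes_le hle
      let r : DeltaSpec Δ S := ⟨⟨q', hq'.isPrime⟩, (p.2.map hf).of_mem_minimalPrimes hq'⟩
      refine ⟨r, ?_, ?_⟩
      · exact ((PrimeSpectrum.le_iff_specializes r.1 q).1 hle').mem_open hV hq
      · refine Subtype.ext (PrimeSpectrum.ext (le_antisymm ?_ ?_))
        · rw [← hqp]
          exact Ideal.comap_mono hle'
        · exact Ideal.map_le_iff_le_comap.1 hq'.le
  rw [this]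
  exact (h V hV).preimage continuous_subtype_val

/-! ### Iterated derivatives and the ranking by multi-indices -/

open scoped IsMulCommutative in
/-- The iterated derivatives `∂^θ x`, for all multi-indices `θ`. -/
theorem exists_iterated_der (Δ R : Type*) [CommRing R] [DeltaRing Δ R] :
    ∃ d : (Δ →₀ ℕ) → R → R, (∀ x, d 0 x = x) ∧
      ∀ θ i x, d (θ + Finsupp.single i 1) x = DeltaRing.der i (d θ x) := by
  let δ : Δ → Module.End ℤ R := fun i => (DeltaRing.der i : Derivation ℤ R R)
  have hcomm : ∀ a ∈ Set.range δ, ∀ b ∈ Set.range δ, a * b = b * a := by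
    rintro _ ⟨i, rfl⟩ _ ⟨j, rfl⟩
    exact LinearMap.ext fun x => DeltaRing.der_comm i j x
  -- `Finsupp.prod` needs a commutative monoid; the one generated by the commuting derivations
  -- serves.
  have := Submonoid.isMulCommutative_closure _ hcomm
  let e : Δ → Submonoid.closure (Set.range δ) :=
    fun i => ⟨δ i, Submonoid.subset_closure (Set.mem_range_self i)⟩
  refine ⟨fun θ => (θ.prod fun i k => e i ^ k : Submonoid.closure (Set.range δ)).1,
    fun x => by simp, fun θ i x => ?_⟩
  have h : (θ + Finsupp.single i 1).prod (fun i k => e i ^ k) =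
      e i * θ.prod fun i k => e i ^ k := by
    classical
    rw [Finsupp.prod_add_index' (h := fun i k => e i ^ k) (fun _ => pow_zero _)
      (fun _ _ _ => pow_add _ _ _), Finsupp.prod_single_index (h := fun i k => e i ^ k) (pow_zero _),
      pow_one, mul_comm]
  exact congrArg (fun f : Submonoid.closure (Set.range δ) => f.1 x) h

/-- The ranking compares multi-indices by a monomial order first and the generators second. -/
theorem genericallyOpen_of_deltaFiniteType {Δ A B : Type*} [Finite Δ] [CommRing A] [CommRing B]
    [DeltaRing Δ A] [DeltaRing Δ B] [Algebra A B] [IsDomain B] [CharZero B]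
    (hinj : Function.Injective (algebraMap A B)) (hdiff : IsDeltaHom Δ (algebraMap A B))
    (hfg : DeltaFiniteType Δ A B) : GenericallyOpen A B := by
  classical
  obtain ⟨t, ht⟩ := hfg
  obtain ⟨k, ⟨e⟩⟩ := Finite.exists_equiv_fin Δ
  let : LinearOrder Δ := LinearOrder.lift' e e.injective
  let m : MonomialOrder Δ := MonomialOrder.lex
  obtain ⟨d, hd0, hd⟩ := exists_iterated_der Δ B
  let x : Fin t.card → B := fun j => t.equivFin.symm j
  let σ : Δ → m.syn ×ₗ Fin t.card → m.syn ×ₗ Fin t.card := fun i a =>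
    toLex ((ofLex a).1 + m.toSyn (Finsupp.single i 1), (ofLex a).2)
  let u : m.syn ×ₗ Fin t.card → B := fun a => d (m.toSyn.symm (ofLex a).1) (x (ofLex a).2)
  have hu : ∀ i a, u (σ i a) = DeltaRing.der i (u a) := fun i a => by
    simp only [u, σ, ofLex_toLex, map_add, AddEquiv.symm_apply_apply, hd]
  refine genericallyOpen_of_ranking (σ := σ) (u := u) hinj hdiff (fun i a b hab => ?_)
    (fun i a => ?_) (fun L hL => ?_) hu ?_
  · rw [Prod.Lex.lt_iff] at hab ⊢
    rcases hab with hab | ⟨hab, hab'⟩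
    · exact .inl (add_lt_add_left hab _)
    · exact .inr ⟨congrArg (· + m.toSyn (Finsupp.single i 1)) hab, hab'⟩
  · rw [Prod.Lex.lt_iff]
    exact .inl (lt_add_of_pos_right _ (m.toSyn_lt_iff_ne_zero.2 (by simp)))
  · let M : Fin t.card → Set (Δ →₀ ℕ) := fun j => {θ | toLex (m.toSyn θ, j) ∈ L}
    -- Dickson's lemma: for each generator the multi-indices in `L` have finitely many minimal
    -- elements.
    have hM : ∀ j, (M j).IsPWO := fun j => Set.isPWO_of_wellQuasiOrderedLE _
    have hfin : ∀ j, {θ | Minimal (· ∈ M j) θ}.Finite := fun j =>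
      (setOfPred_minimal_antichain _).finite_of_partiallyWellOrderedOn
        ((hM j).mono (setOfPred_minimal_subset _))
    refine ⟨Finset.univ.biUnion fun j => (hfin j).toFinset.image fun θ => toLex (m.toSyn θ, j),
      fun a ha => ?_, fun b hb => ?_⟩
    · obtain ⟨j, -, ha⟩ := Finset.mem_biUnion.1 (Finset.mem_coe.1 ha)
      obtain ⟨θ, hθ, rfl⟩ := Finset.mem_image.1 ha
      exact ((hfin j).mem_toFinset.1 hθ).1
    · obtain ⟨θ, hθ⟩ := m.toSyn.surjective (ofLex b).1
      have hb' : θ ∈ M (ofLex b).2 := by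
        change toLex (m.toSyn θ, (ofLex b).2) ∈ L
        rwa [hθ]
      obtain ⟨η, hη, hmin⟩ := (hM _).exists_le_minimal hb'
      refine ⟨toLex (m.toSyn η, (ofLex b).2), Finset.mem_biUnion.2 ⟨_, Finset.mem_univ _,
        Finset.mem_image_of_mem _ ((hfin _).mem_toFinset.2 hmin)⟩, ?_⟩
      obtain ⟨ζ, rfl⟩ := exists_add_of_le hη
      have hreach : ∀ ζ η : Δ →₀ ℕ, Relation.ReflTransGen (fun a b => ∃ i, b = σ i a)
          (toLex (m.toSyn η, (ofLex b).2)) (toLex (m.toSyn (η + ζ), (ofLex b).2)) := by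
        intro ζ
        induction ζ using Finsupp.induction_linear with
        | zero =>
          intro η
          rw [add_zero]
        | add ζ ξ hζ hξ =>
          intro η
          rw [← add_assoc]
          exact (hζ η).trans (hξ (η + ζ))
        | single i n =>
          intro η
          induction n with
          | zero => rw [Finsupp.single_zero, add_zero]
          | succ n ih =>
            refine ih.tail ⟨i, ?_⟩
            simp only [σ, ofLex_toLex, Finsupp.single_add, ← add_assoc, map_add]
      have := hreach ζ η
      rwa [hθ] at this
  · rw [← top_le_iff, ← ht]
    refine sInf_le ⟨fun y hy => ?_, fun i y hy => ?_⟩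
    · refine Algebra.subset_adjoin ⟨toLex (0, t.equivFin ⟨y, hy⟩), ?_⟩
      simp only [u, x, ofLex_toLex, map_zero, hd0, Equiv.symm_apply_apply]
    · rw [← Set.image_univ] at hy ⊢
      exact der_mem_adjoin hdiff hu subset_rfl (fun _ _ => Set.mem_univ _) hy

theorem mainTheorem4 {Δ : Type*} [Finite Δ] {A B : Type*} [CommRing A] [CommRing B]
    [Algebra ℚ A] [Algebra ℚ B] [DeltaRing Δ A] [DeltaRing Δ B]
    [Algebra A B] (hinj : Function.Injective (algebraMap A B))
    (hdiff : IsDeltaHom Δ (algebraMap A B))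
    [IsDomain B] (hfg : DeltaFiniteType Δ A B)
    [TopologicalSpace.NoetherianSpace (DeltaSpec Δ A)] :
    ∃ s : B, s ≠ 0 ∧
      IsOpenMap (DeltaSpec.comap
        ((algebraMap B (Localization.Away s)).comp (algebraMap A B))
        ((isDeltaHom_algebraMap_localization Δ (Submonoid.powers s)).comp hdiff)) := by
  have : CharZero B := algebraRat.charZero B
  obtain ⟨s, hs, h⟩ := genericallyOpen_of_deltaFiniteType hinj hdiff hfg
  exact ⟨s, hs, DeltaSpec.isOpenMap_comap _ (h.isOpenMap (Localization.Away s))⟩
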